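/- **Theorem.** A *one-$\mathbb{Z}$-counter system* $\mathcal{O}$ consists of a finite set $Q$ of states, a set $T_{>0}$ of positive transitions, a set $T_{<0}$ of negative transitions and a set $T_{=0}$ of zero tests, where $T_{>0}, T_{<0}, T_{=0} \subseteq Q\times\{-1,0,1\}\times Q$. Its configurations are the pairs $(q,c)\in Q\times\mathbb{Z}$, where $c$ is the counter value. A transition $t=(q,d,q')$ can be fired in $(q,c)$ if $c>0$ and $t\in T_{>0}$, or $c<0$ and $t\in T_{<0}$, or $c=0$ and $t\in T_{=0}$; firing it results in the configuration $(q',c+d)$. A *path* of length $m\ge 0$ from a configuration $\alpha$ to a configuration $\beta$ is a sequence $(\gamma_1,t_1)(\gamma_2,t_2)\cdots(\gamma_m,t_m)$ of pairs of a configuration and a transition for which, with $\gamma_{m+1}=\beta$, we have $\gamma_1=\alpha$ and for each $i=1,\dots,m$ the transition $t_i$ can be fired in $\gamma_i$ and results in $\gamma_{i+1}$ (the empty sequence is a path from each configuration to itself). The configuration $\beta$ is *reachable* from $\alpha$ if there is a path from $\alpha$ to $\beta$. Let $\mathcal{O}$ be a one-$\mathbb{Z}$-counter system with $n$ states. Suppose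 that a configuration $\beta$ with counter value $c_\beta$ is reachable in $\mathcal{O}$ from a configuration $\alpha$ with counter value $c_\alpha$. Then $\mathcal{O}$ has a path from $\alpha$ to $\beta$ of length at most $56n^2+n\cdot(|c_\alpha|+|c_\beta|)$. -/

import Mathlib

/-- A one-`ℤ`-counter system with state set `Q`. A transition is a triple `(q, d, q')`:
source state, effect on the counter, target state. -/
structure ZOCS (Q : Type*) where
  /-- positive transitions, fireable when the counter value is positive -/
  pos : Set (Q × ℤ × Q)
  /-- negative transitions, fireable when the counter value is negative -/
  neg : Set (Q × ℤ × Q)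
  /-- zero tests, fireable when the counter value is zero -/
  zero : Set (Q × ℤ × Q)
  pos_eff : ∀ t ∈ pos, t.2.1 ∈ ({-1, 0, 1} : Set ℤ)
  neg_eff : ∀ t ∈ neg, t.2.1 ∈ ({-1, 0, 1} : Set ℤ)
  zero_eff : ∀ t ∈ zero, t.2.1 ∈ ({-1, 0, 1} : Set ℤ)

namespace ZOCS

/-- Transition `t` can be fired in configuration `γ`. -/
def CanFire {Q : Type*} (O : ZOCS Q) (γ : Q × ℤ) (t : Q × ℤ × Q) : Prop :=
  γ.1 = t.1 ∧
    ((t ∈ O.pos ∧ 0 < γ.2) ∨ (t ∈ O.neg ∧ γ.2 < 0) ∨ (t ∈ O.zero ∧ γ.2 = 0))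

/-- Firing `t` at configuration `γ` is possible and results in configuration `γ'`. -/
def Fires {Q : Type*} (O : ZOCS Q) (γ : Q × ℤ) (t : Q × ℤ × Q) (γ' : Q × ℤ) : Prop :=
  O.CanFire γ t ∧ γ' = (t.2.2, γ.2 + t.2.1)

/-- `O.IsPath α ρ β`: the word `ρ = (γ₁, t₁) ⋯ (γₘ, tₘ)` is a path of `O` with source `α` and
target `β`, that is, `α = γ₁`, `β = γₘ₊₁`, and firing `tᵢ` at `γᵢ` results in `γᵢ₊₁`. The empty
word is a path from each configuration to itself. The length of the path is `ρ.length`. -/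
inductive IsPath {Q : Type*} (O : ZOCS Q) :
    Q × ℤ → List ((Q × ℤ) × (Q × ℤ × Q)) → Q × ℤ → Prop
  | nil (α : Q × ℤ) : IsPath O α [] α
  | cons {α γ β : Q × ℤ} {t : Q × ℤ × Q} {ρ : List ((Q × ℤ) × (Q × ℤ × Q))}
      (h : O.Fires α t γ) (hρ : IsPath O γ ρ β) : IsPath O α ((α, t) :: ρ) β

/-- `β` is reachable from `α`. -/
def Reachable {Q : Type*} (O : ZOCS Q) (α β : Q × ℤ) : Prop :=
  ∃ ρ, O.IsPath α ρ β

end ZOCS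

/-! Write n for the number of states. A repetition-free sequence of configurations within distance
3n of the interval spanned by 0 and the two end values has at most n(|c_α| + |c_β| + 6n + 1)
members, so only the higher excursions are a problem. Such an excursion repeats a state at two
levels on its way up and again on its way down. It therefore meets a component with a cycle of
positive effect a and later one with a cycle of negative effect -b, both chosen short. To replace
its high part it suffices to have a linking walk between the two cycles whose effect is right modulo
gcd(a, b): pumping supplies the rest and keeps the counter positive. This weakened relation is
`Frame.Jump`.

In a shortest sequence of steps and jumps, no jump leads from the source of one jump to the target
of a later one. Take shortest linking walks. If two of them, for jumps out of S, met at a vertex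
with equal height modulo a_S, splicing them would merge two jumps or shorten one. So the linking
walks out of S have at most n·a_S positions in total, those into T at most n·b_T, and at most
gcd(a_S, b_T) jumps lead from S to T. Since a cycle of effect a_S is pumped about (k + 3n)/a_S +
b_T/gcd(a_S, b_T) times, the factor a_S cancels and S sees O(n) pumpings of length at most |S|. The
sizes |S| add up to n, which gives a quadratic bound (`Frame.exists_runs`). Negative counter values
are handled by mirroring. -/

/-! ### Walks and their effects -/

/-- `Walk E p k e q`: the graph with labelled edges `E` has a walk from `p` to `q` with `k` edges
and total effect `e`. -/
inductive Walk {Q : Type*} (E : Set (Q × ℤ × Q)) : Q → ℕ → ℤ → Q → Prop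
  | nil (p : Q) : Walk E p 0 0 p
  | cons {p q r : Q} {d e : ℤ} {k : ℕ} (h : (p, d, q) ∈ E) (hw : Walk E q k e r) :
      Walk E p (k + 1) (d + e) r

namespace Walk

variable {Q : Type*} {E : Set (Q × ℤ × Q)}

theorem append {p q r : Q} {k k' : ℕ} {e e' : ℤ} (h : Walk E p k e q) (h' : Walk E q k' e' r) :
    Walk E p (k + k') (e + e') r := by
  induction h with
  | nil p => simpa using h'
  | cons hd _ ih =>
    have := Walk.cons hd (ih h')
    rwa [← add_assoc, add_right_comm] at this

theorem pow {p : Q} {k : ℕ} {e : ℤ} (h : Walk E p k e p) (j : ℕ) :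
    Walk E p (j * k) (j * e) p := by
  induction j with
  | zero => simpa using Walk.nil p
  | succ j ih =>
    have := ih.append h
    rw [Nat.succ_mul]
    convert this using 1
    push_cast; ring

theorem abs_effect_le (hE : ∀ t ∈ E, |t.2.1| ≤ 1) {p q : Q} {k : ℕ} {e : ℤ}
    (h : Walk E p k e q) : |e| ≤ k := by
  induction h with
  | nil p => simp
  | cons hd _ ih =>
    have := hE _ hd
    simp only [abs_le] at *
    push_cast
    omega

theorem of_seq {f : ℕ → Q} {w : ℕ → ℤ} (i k : ℕ)
    (h : ∀ t, i ≤ t → t < i + k → (f t, w (t + 1) - w t, f (t + 1)) ∈ E) :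
    Walk E (f i) k (w (i + k) - w i) (f (i + k)) := by
  induction k generalizing i with
  | zero => simpa using Walk.nil (f i)
  | succ k ih =>
    have := Walk.cons (h i le_rfl (by omega))
      (ih (i + 1) (fun t h1 h2 => h t (by omega) (by omega)))
    rw [show i + 1 + k = i + (k + 1) by ring] at this
    convert this using 1
    ring

theorem of_seq_le {f : ℕ → Q} {w : ℕ → ℤ} {i j : ℕ} (hij : i ≤ j)
    (h : ∀ t, i ≤ t → t < j → (f t, w (t + 1) - w t, f (t + 1)) ∈ E) :
    Walk E (f i) (j - i) (w j - w i) (f j) := by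
  obtain ⟨k, rfl⟩ := Nat.exists_eq_add_of_le hij
  simpa using of_seq i k h

theorem exists_seq {p q : Q} {k : ℕ} {e : ℤ} (h : Walk E p k e q) :
    ∃ (f : ℕ → Q) (w : ℕ → ℤ), f 0 = p ∧ w 0 = 0 ∧ f k = q ∧ w k = e ∧
      ∀ t < k, (f t, w (t + 1) - w t, f (t + 1)) ∈ E := by
  induction h with
  | nil p => exact ⟨fun _ => p, fun _ => 0, rfl, rfl, rfl, rfl, by simp⟩
  | @cons p q r d e k hd _ ih =>
    obtain ⟨f, w, h1, h2, h3, h4, h5⟩ := ih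
    refine ⟨fun t => Nat.casesOn t p f, fun t => Nat.casesOn t 0 (fun t => d + w t),
      rfl, rfl, h3, by simp [h4], ?_⟩
    intro t ht
    cases t with
    | zero => simpa [h1, h2] using hd
    | succ t => simpa using h5 t (by omega)

/-- Whenever a vertex is reachable, it is reachable by a walk of length at most the number of
vertices. -/
theorem exists_short [Fintype Q] {p q : Q} {k : ℕ} {e : ℤ} (h : Walk E p k e q) :
    ∃ k' ≤ Fintype.card Q, ∃ e', Walk E p k' e' q := by
  classical
  have hex : ∃ k e, Walk E p k e q := ⟨k, e, h⟩
  obtain ⟨e', he'⟩ := Nat.find_spec hex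
  refine ⟨_, ?_, e', he'⟩
  by_contra! hlt
  obtain ⟨f, w, h1, h2, h3, h4, h5⟩ := he'.exists_seq
  obtain ⟨x, y, hxy, hf⟩ := Fintype.exists_ne_map_eq_of_card_lt
    (fun i : Fin (Nat.find hex) => f i) (by simpa using hlt)
  wlog hlt' : x < y generalizing x y
  · exact this y x hxy.symm hf.symm (lt_of_le_of_ne (not_lt.1 hlt') hxy.symm)
  have hx : (x : ℕ) < y := hlt'
  have hy := y.2
  have w1 : Walk E (f 0) (x - 0) (w x - w 0) (f x) :=
    of_seq_le (Nat.zero_le _) (fun t _ ht => h5 t (by omega))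
  have w2 : Walk E (f y) (Nat.find hex - y) (w (Nat.find hex) - w y) (f (Nat.find hex)) :=
    of_seq_le hy.le (fun t _ ht => h5 t (by omega))
  rw [← hf, h3] at w2
  rw [h1] at w1
  exact Nat.find_min hex (m := x - 0 + (Nat.find hex - y)) (by omega) ⟨_, w1.append w2⟩

end Walk

/-! ### Strongly connected components and short cycles of given sign -/

/-- Mutual reachability in the graph with labelled edges `E`. -/
def mutualSetoid {Q : Type*} (E : Set (Q × ℤ × Q)) : Setoid Q where
  r p q := (∃ k e, Walk E p k e q) ∧ ∃ k e, Walk E q k e p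
  iseqv :=
    { refl := fun p => ⟨⟨0, 0, .nil p⟩, ⟨0, 0, .nil p⟩⟩
      symm := fun h => ⟨h.2, h.1⟩
      trans := by
        rintro p q r ⟨⟨_, _, h1⟩, ⟨_, _, h2⟩⟩ ⟨⟨_, _, h3⟩, ⟨_, _, h4⟩⟩
        exact ⟨⟨_, _, h1.append h3⟩, ⟨_, _, h4.append h2⟩⟩ }

/-- The strongly connected components of the graph with labelled edges `E`. -/
abbrev Component {Q : Type*} (E : Set (Q × ℤ × Q)) : Type _ := Quotient (mutualSetoid E)

/-- The strongly connected component of a vertex. -/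
def component {Q : Type*} (E : Set (Q × ℤ × Q)) (p : Q) : Component E := Quotient.mk _ p

theorem component_eq_iff {Q : Type*} {E : Set (Q × ℤ × Q)} {p q : Q} :
    component E p = component E q ↔ (∃ k e, Walk E p k e q) ∧ ∃ k e, Walk E q k e p :=
  Quotient.eq (r := mutualSetoid E)

noncomputable instance {Q : Type*} [Fintype Q] (E : Set (Q × ℤ × Q)) : Fintype (Component E) :=
  Fintype.ofFinite _

open Classical in
/-- The number of vertices of a strongly connected component. -/
noncomputable def compSize {Q : Type*} [Fintype Q] (E : Set (Q × ℤ × Q)) (S : Component E) : ℕ :=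
  (Finset.univ.filter fun p => component E p = S).card

theorem sum_compSize {Q : Type*} [Fintype Q] (E : Set (Q × ℤ × Q)) :
    ∑ S, compSize E S = Fintype.card Q := by
  classical
  exact (Finset.card_eq_sum_card_fiberwise (f := component E) (s := Finset.univ)
    (t := Finset.univ) (by simp)).symm

/-- A closed walk of the component `S` through `c`, of length `l` and effect `σ * a`, with
`0 < a ≤ l ≤ |S|`. -/
def IsCycle {Q : Type*} [Fintype Q] (E : Set (Q × ℤ × Q)) (σ : ℤ) (S : Component E)
    (x : Q × ℕ × ℕ) : Prop :=
  component E x.1 = S ∧ x.2.1 ≤ compSize E S ∧ 0 < x.2.2 ∧ x.2.2 ≤ x.2.1 ∧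
    Walk E x.1 x.2.1 (σ * x.2.2) x.1

/-- Take a shortest closed walk of sign `σ` based anywhere in the component. A repeated vertex would
split it into two shorter closed walks whose effects add up, and one of these would again have sign
`σ`. -/
theorem exists_isCycle {Q : Type*} [Fintype Q] {E : Set (Q × ℤ × Q)}
    (hE : ∀ t ∈ E, |t.2.1| ≤ 1) {σ : ℤ} (hσ : |σ| = 1) {p : Q} {k : ℕ} {e : ℤ}
    (h : Walk E p k e p) (he : 0 < σ * e) : ∃ x, IsCycle E σ (component E p) x := by
  classical
  have hex : ∃ k c e, component E c = component E p ∧ 0 < σ * e ∧ Walk E c k e c :=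
    ⟨k, p, e, rfl, he, h⟩
  obtain ⟨c, e', hc, he', hw⟩ := Nat.find_spec hex
  have hσ' : σ * σ = 1 := by rw [← abs_mul_abs_self, hσ]; rfl
  have hcast : ((σ * e').toNat : ℤ) = σ * e' := Int.toNat_of_nonneg he'.le
  refine ⟨(c, Nat.find hex, (σ * e').toNat), hc, ?_, by simpa using he', ?_, ?_⟩
  · by_contra! hlt
    dsimp only at hlt
    obtain ⟨f, w, h1, h2, h3, h4, h5⟩ := hw.exists_seq
    have key : ∀ i j, i ≤ j → j ≤ Nat.find hex →
        Walk E (f i) (j - i) (w j - w i) (f j) := fun i j hij hj =>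
      Walk.of_seq_le hij (fun t _ ht => h5 t (by omega))
    have hcomp : ∀ i ≤ Nat.find hex, component E (f i) = component E p := by
      intro i hi
      rw [← hc, component_eq_iff]
      refine ⟨⟨_, _, h3 ▸ key i _ hi le_rfl⟩, ⟨_, _, h1 ▸ key 0 i (Nat.zero_le _) hi⟩⟩
    obtain ⟨x, hx, y, hy, hxy, hf⟩ := Finset.exists_ne_map_eq_of_card_lt_of_maps_to
      (s := Finset.range (Nat.find hex))
      (t := Finset.univ.filter fun q => component E q = component E p) (f := f)
      (by simpa [compSize] using hlt) (by
        intro i hi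
        simp only [Finset.coe_range, Set.mem_Iio] at hi
        simpa using hcomp i hi.le)
    simp only [Finset.mem_range] at hx hy
    wlog hlt' : x < y generalizing x y
    · exact this y x hxy.symm hf.symm hy hx (lt_of_le_of_ne (not_lt.1 hlt') hxy.symm)
    have w1 := key 0 x (Nat.zero_le _) hx.le
    have w2 := key x y hlt'.le hy.le
    have w3 := key y _ hy.le le_rfl
    rw [h3, ← hf] at w3
    rw [h1] at w1
    rw [← hf] at w2
    by_cases hpos : 0 < σ * (w y - w x)
    · exact Nat.find_min hex (m := y - x) (by omega) ⟨_, _, hcomp x hx.le, hpos, w2⟩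
    · refine Nat.find_min hex (m := x - 0 + (Nat.find hex - y)) (by omega)
        ⟨_, _, hc, ?_, w1.append w3⟩
      rw [h4, h2]
      have : σ * (w x - 0 + (e' - w y)) = σ * e' - σ * (w y - w x) := by ring
      omega
  · have h1 := hw.abs_effect_le hE
    have h2 : σ * e' ≤ |e'| := by
      calc σ * e' ≤ |σ * e'| := le_abs_self _
        _ = |e'| := by rw [abs_mul, hσ, one_mul]
    dsimp only
    omega
  · dsimp only
    rw [hcast, ← mul_assoc, hσ', one_mul]
    exact hw

/-- The graph with labelled edges `E` has a closed walk in the component `S` whose effect has the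
sign `σ`. -/
def HasCycle {Q : Type*} [Fintype Q] (E : Set (Q × ℤ × Q)) (σ : ℤ) (S : Component E) : Prop :=
  ∃ x, IsCycle E σ S x

/-- A choice of a closed walk of positive effect (through `c S`, of length `l S` and effect `a S`)
and of a closed walk of negative effect (through `d S`, of length `m S` and effect `-b S`) in every
strongly connected component `S` that has one, and of effects `toC s` and `fromD s` of short walks
from `s` to the former and from the latter to `s`. -/
structure Frame {Q : Type*} [Fintype Q] (E : Set (Q × ℤ × Q)) where
  c : Component E → Q
  l : Component E → ℕ
  a : Component E → ℕ
  d : Component E → Q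
  m : Component E → ℕ
  b : Component E → ℕ
  toC : Q → ℤ
  fromD : Q → ℤ
  l_le : ∀ S, l S ≤ compSize E S
  a_le : ∀ S, a S ≤ compSize E S
  m_le : ∀ S, m S ≤ compSize E S
  b_le : ∀ S, b S ≤ compSize E S
  up : ∀ S, HasCycle E 1 S → component E (c S) = S ∧ 0 < a S ∧ Walk E (c S) (l S) (a S) (c S)
  dn : ∀ S, HasCycle E (-1) S →
    component E (d S) = S ∧ 0 < b S ∧ Walk E (d S) (m S) (-(b S)) (d S)
  toC_spec : ∀ s, HasCycle E 1 (component E s) →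
    ∃ k ≤ Fintype.card Q, Walk E s k (toC s) (c (component E s))
  fromD_spec : ∀ s, HasCycle E (-1) (component E s) →
    ∃ k ≤ Fintype.card Q, Walk E (d (component E s)) k (fromD s) s

theorem Frame.nonempty {Q : Type*} [Fintype Q] (E : Set (Q × ℤ × Q)) : Nonempty (Frame E) := by
  classical
  have hσ : ∀ σ : ℤ, ∃ x : Component E → Q × ℕ × ℕ, ∀ S,
      (x S).2.1 ≤ compSize E S ∧ (x S).2.2 ≤ compSize E S ∧ (HasCycle E σ S →
        component E (x S).1 = S ∧ 0 < (x S).2.2 ∧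
          Walk E (x S).1 (x S).2.1 (σ * (x S).2.2) (x S).1) := by
    intro σ
    have : ∀ S : Component E, ∃ x : Q × ℕ × ℕ,
      x.2.1 ≤ compSize E S ∧ x.2.2 ≤ compSize E S ∧ (HasCycle E σ S →
        component E x.1 = S ∧ 0 < x.2.2 ∧ Walk E x.1 x.2.1 (σ * x.2.2) x.1) := by
      intro S
      by_cases h : HasCycle E σ S
      · obtain ⟨x, h1, h2, h3, h4, h5⟩ := h
        exact ⟨x, h2, h4.trans h2, fun _ => ⟨h1, h3, h5⟩⟩
      -- Length and effect 0 keep the size bounds valid for every component, so that they can be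
      -- summed over all components.
      · exact ⟨(Quotient.out S, 0, 0), Nat.zero_le _, Nat.zero_le _, fun h' => absurd h' h⟩
    choose x hx using this
    exact ⟨x, hx⟩
  obtain ⟨x, hx⟩ := hσ 1
  obtain ⟨y, hy⟩ := hσ (-1)
  have hto : ∀ s, ∃ e, HasCycle E 1 (component E s) →
      ∃ k ≤ Fintype.card Q, Walk E s k e (x (component E s)).1 := by
    intro s
    by_cases h : HasCycle E 1 (component E s)
    · obtain ⟨⟨_, _, -⟩, ⟨_, _, hw⟩⟩ := component_eq_iff.1 ((hx _).2.2 h).1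
      obtain ⟨k, hk, e, he⟩ := hw.exists_short
      exact ⟨e, fun _ => ⟨k, hk, he⟩⟩
    · exact ⟨0, fun h' => absurd h' h⟩
  have hfrom : ∀ s, ∃ e, HasCycle E (-1) (component E s) →
      ∃ k ≤ Fintype.card Q, Walk E (y (component E s)).1 k e s := by
    intro s
    by_cases h : HasCycle E (-1) (component E s)
    · obtain ⟨⟨_, _, hw⟩, -⟩ := component_eq_iff.1 ((hy _).2.2 h).1
      obtain ⟨k, hk, e, he⟩ := hw.exists_short
      exact ⟨e, fun _ => ⟨k, hk, he⟩⟩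
    · exact ⟨0, fun h' => absurd h' h⟩
  choose u hu using hto
  choose v hv using hfrom
  exact ⟨{
    c := fun S => (x S).1
    l := fun S => (x S).2.1
    a := fun S => (x S).2.2
    d := fun S => (y S).1
    m := fun S => (y S).2.1
    b := fun S => (y S).2.2
    toC := u
    fromD := v
    l_le := fun S => (hx S).1
    a_le := fun S => (hx S).2.1
    m_le := fun S => (hy S).1
    b_le := fun S => (hy S).2.1
    up := fun S h => by simpa using (hx S).2.2 h
    dn := fun S h => by simpa using (hy S).2.2 h
    toC_spec := hu
    fromD_spec := hv }⟩

theorem card_le_of_separated {ι Q : Type*} [Fintype Q] (A : Finset ι) (f : ι → Q) (r : ι → ℤ)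
    {m : ℕ} (hm : 0 < m)
    (h : ∀ x ∈ A, ∀ y ∈ A, f x = f y → (m : ℤ) ∣ r x - r y → x = y) :
    A.card ≤ Fintype.card Q * m := by
  classical
  have : NeZero m := ⟨hm.ne'⟩
  have := Finset.card_le_card_of_injOn (s := A) (t := (Finset.univ : Finset (Q × ZMod m)))
    (fun x => (f x, (r x : ZMod m))) (by simp) (by
      intro x hx y hy hxy
      simp only [Prod.mk.injEq] at hxy
      refine h x hx y hy hxy.1 ?_
      have := (ZMod.intCast_eq_intCast_iff_dvd_sub _ _ _).1 hxy.2.symm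
      exact this)
  simpa [Fintype.card_prod, ZMod.card] using this

/-! ### Jumps and families of shortest linking walks -/

namespace Frame

variable {Q : Type*} [Fintype Q] {E : Set (Q × ℤ × Q)}

/-- The chosen walks and cycles at `γ` and `γ'` can be joined by a walk of length `k` and effect
`e`, up to pumping the chosen cycles. -/
def Link (F : Frame E) (γ γ' : Q × ℤ) (k : ℕ) (e : ℤ) : Prop :=
  Walk E (F.c (component E γ.1)) k e (F.d (component E γ'.1)) ∧
    (Nat.gcd (F.a (component E γ.1)) (F.b (component E γ'.1)) : ℤ) ∣
      (γ'.2 - F.fromD γ'.1) - (γ.2 + F.toC γ.1) - e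

/-- The configurations `γ` and `γ'`, at heights a little above `P`, can be joined by a run that
pumps the chosen cycles. -/
def Jump (F : Frame E) (P : ℤ) (γ γ' : Q × ℤ) : Prop :=
  HasCycle E 1 (component E γ.1) ∧ HasCycle E (-1) (component E γ'.1) ∧
    (P + 2 * Fintype.card Q ≤ γ.2 ∧ γ.2 ≤ P + 3 * Fintype.card Q) ∧
    (P + 2 * Fintype.card Q ≤ γ'.2 ∧ γ'.2 ≤ P + 3 * Fintype.card Q) ∧ ∃ k e, F.Link γ γ' k e

/-- A finite family of jumps, none of which can be merged with a later one, together with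
shortest linking walks. -/
structure Family (F : Frame E) (P : ℤ) (I : Finset ℕ) (γ γ' : ℕ → Q × ℤ) (k : ℕ → ℕ)
    (f : ℕ → ℕ → Q) (w : ℕ → ℕ → ℤ) : Prop where
  jump : ∀ i ∈ I, F.Jump P (γ i) (γ' i)
  start : ∀ i ∈ I, f i 0 = F.c (component E (γ i).1)
  start_zero : ∀ i ∈ I, w i 0 = 0
  finish : ∀ i ∈ I, f i (k i) = F.d (component E (γ' i).1)
  edge : ∀ i ∈ I, ∀ t < k i, (f i t, w i (t + 1) - w i t, f i (t + 1)) ∈ E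
  dvd : ∀ i ∈ I, (Nat.gcd (F.a (component E (γ i).1)) (F.b (component E (γ' i).1)) : ℤ) ∣
    ((γ' i).2 - F.fromD (γ' i).1) - ((γ i).2 + F.toC (γ i).1) - w i (k i)
  minimal : ∀ i ∈ I, ∀ j ∈ I, i ≤ j → ∀ κ ε, F.Link (γ i) (γ' j) κ ε → i = j ∧ k i ≤ κ

theorem exists_family (F : Frame E) (P : ℤ) (I : Finset ℕ) (γ γ' : ℕ → Q × ℤ)
    (hJ : ∀ i ∈ I, F.Jump P (γ i) (γ' i))
    (hno : ∀ i ∈ I, ∀ j ∈ I, i < j → ¬ F.Jump P (γ i) (γ' j)) :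
    ∃ k f w, F.Family P I γ γ' k f w := by
  classical
  have : Nonempty Q := ⟨(γ 0).1⟩
  have : ∀ i ∈ I, ∃ (k : ℕ) (f : ℕ → Q) (w : ℕ → ℤ), f 0 = F.c (component E (γ i).1) ∧ w 0 = 0 ∧
      f k = F.d (component E (γ' i).1) ∧ (∀ t < k, (f t, w (t + 1) - w t, f (t + 1)) ∈ E) ∧
      ((Nat.gcd (F.a (component E (γ i).1)) (F.b (component E (γ' i).1)) : ℤ) ∣
        ((γ' i).2 - F.fromD (γ' i).1) - ((γ i).2 + F.toC (γ i).1) - w k) ∧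
      ∀ κ ε, F.Link (γ i) (γ' i) κ ε → k ≤ κ := by
    intro i hi
    obtain ⟨-, -, -, -, hex⟩ := hJ i hi
    obtain ⟨e, hw, hd⟩ := Nat.find_spec hex
    obtain ⟨f, w, h1, h2, h3, h4, h5⟩ := hw.exists_seq
    exact ⟨_, f, w, h1, h2, h3, h5, h4 ▸ hd, fun κ ε hl => Nat.find_min' hex ⟨ε, hl⟩⟩
  choose! k f w h1 h2 h3 h4 h5 h6 using this
  refine ⟨k, f, w, hJ, h1, h2, h3, h4, h5, ?_⟩
  intro i hi j hj hij κ ε hl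
  rcases hij.eq_or_lt with rfl | hlt
  · exact ⟨rfl, h6 i hi κ ε hl⟩
  · obtain ⟨a1, -, a3, -, -⟩ := hJ i hi
    obtain ⟨-, b2, -, b4, -⟩ := hJ j hj
    exact absurd ⟨a1, b2, a3, b4, κ, ε, hl⟩ (hno i hi j hj hlt)

namespace Family

variable {F : Frame E} {P : ℤ} {I : Finset ℕ} {γ γ' : ℕ → Q × ℤ} {k : ℕ → ℕ} {f : ℕ → ℕ → Q}
  {w : ℕ → ℕ → ℤ}

theorem a_pos (h : F.Family P I γ γ' k f w) {i : ℕ} (hi : i ∈ I) :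
    0 < F.a (component E (γ i).1) := (F.up _ (h.jump i hi).1).2.1

theorem b_pos (h : F.Family P I γ γ' k f w) {i : ℕ} (hi : i ∈ I) :
    0 < F.b (component E (γ' i).1) := (F.dn _ (h.jump i hi).2.1).2.1

theorem link_of_eq (h : F.Family P I γ γ' k f w) {i j t t' : ℕ} (hi : i ∈ I) (hj : j ∈ I)
    (ht : t ≤ k i) (ht' : t' ≤ k j) (hf : f i t = f j t')
    (hd : (Nat.gcd (F.a (component E (γ i).1)) (F.b (component E (γ' j).1)) : ℤ) ∣
      ((γ' j).2 - F.fromD (γ' j).1) - ((γ i).2 + F.toC (γ i).1) -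
        (w i t + (w j (k j) - w j t'))) :
    F.Link (γ i) (γ' j) (t + (k j - t')) (w i t + (w j (k j) - w j t')) := by
  refine ⟨?_, hd⟩
  have w1 : Walk E (f i 0) (t - 0) (w i t - w i 0) (f i t) :=
    Walk.of_seq_le (Nat.zero_le _) (fun u _ hu => h.edge i hi u (by omega))
  have w2 : Walk E (f j t') (k j - t') (w j (k j) - w j t') (f j (k j)) :=
    Walk.of_seq_le ht' (fun u _ hu => h.edge j hj u (by omega))
  rw [h.start i hi, h.start_zero i hi, sub_zero, Nat.sub_zero, hf] at w1
  rw [h.finish j hj] at w2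
  exact w1.append w2

/-- The heights compared are those computed from the source without pumping. As they agree modulo
the gcd, the spliced walk inherits the congruence of jump `j`. -/
theorem link_start (h : F.Family P I γ γ' k f w) {i j : ℕ} {t t' : ℕ} (hi : i ∈ I) (hj : j ∈ I)
    (ht : t ≤ k i) (ht' : t' ≤ k j) (hc : component E (γ i).1 = component E (γ j).1)
    (hf : f i t = f j t') {g : ℤ}
    (hg : (Nat.gcd (F.a (component E (γ i).1)) (F.b (component E (γ' j).1)) : ℤ) ∣ g)
    (hd : g ∣ ((γ i).2 + F.toC (γ i).1 + w i t) - ((γ j).2 + F.toC (γ j).1 + w j t')) :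
    F.Link (γ i) (γ' j) (t + (k j - t')) (w i t + (w j (k j) - w j t')) := by
  refine h.link_of_eq hi hj ht ht' hf ?_
  have h1 := hg.trans hd
  have h2 := h.dvd j hj
  rw [← hc] at h2
  refine (dvd_sub h2 h1).trans (dvd_of_eq ?_)
  ring

/-- Here heights are computed backwards from the target, and the congruence is inherited from jump
`i`. -/
theorem link_finish (h : F.Family P I γ γ' k f w) {i j : ℕ} {t t' : ℕ} (hi : i ∈ I) (hj : j ∈ I)
    (ht : t ≤ k i) (ht' : t' ≤ k j) (hc : component E (γ' i).1 = component E (γ' j).1)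
    (hf : f i t = f j t') {g : ℤ}
    (hg : (Nat.gcd (F.a (component E (γ i).1)) (F.b (component E (γ' j).1)) : ℤ) ∣ g)
    (hd : g ∣ ((γ' i).2 - F.fromD (γ' i).1 - (w i (k i) - w i t)) -
      ((γ' j).2 - F.fromD (γ' j).1 - (w j (k j) - w j t'))) :
    F.Link (γ i) (γ' j) (t + (k j - t')) (w i t + (w j (k j) - w j t')) := by
  refine h.link_of_eq hi hj ht ht' hf ?_
  have h1 := hg.trans hd
  have h2 := h.dvd i hi
  rw [hc] at h2
  refine (dvd_sub h2 h1).trans (dvd_of_eq ?_)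
  ring

/-- A splice from the earlier jump to the later one is a link, which minimality permits only if `i =
j` and `t' ≤ t`. Exchanging the roles gives `t = t'`, so the positions inject into pairs of a vertex
and a residue modulo `m`. -/
theorem card_le_of_link (h : F.Family P I γ γ' k f w) {J : Finset ℕ} (hJ : J ⊆ I) {m : ℕ}
    (hm : 0 < m) (ρ : ℕ → ℕ → ℤ)
    (hl : ∀ i ∈ J, ∀ j ∈ J, ∀ t ≤ k i, ∀ t' ≤ k j, f i t = f j t' →
      (m : ℤ) ∣ ρ i t - ρ j t' → ∃ ε, F.Link (γ i) (γ' j) (t + (k j - t')) ε) :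
    ∑ i ∈ J, (k i + 1) ≤ Fintype.card Q * m := by
  have hcard : ∑ i ∈ J, (k i + 1) = (J.sigma fun i => Finset.range (k i + 1)).card := by
    simp [Finset.card_sigma]
  rw [hcard]
  refine card_le_of_separated _ (fun x => f x.1 x.2) (fun x => ρ x.1 x.2) hm ?_
  have key : ∀ i ∈ J, ∀ j ∈ J, i ≤ j → ∀ t ≤ k i, ∀ t' ≤ k j, f i t = f j t' →
      (m : ℤ) ∣ ρ i t - ρ j t' → i = j ∧ t' ≤ t := by
    intro i hi j hj hij t ht t' ht' hf hd
    obtain ⟨ε, hε⟩ := hl i hi j hj t ht t' ht' hf hd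
    obtain ⟨rfl, hle⟩ := h.minimal i (hJ hi) j (hJ hj) hij _ _ hε
    exact ⟨rfl, by omega⟩
  rintro ⟨i, t⟩ hx ⟨j, t'⟩ hy hf hd
  simp only [Finset.mem_sigma, Finset.mem_range, Nat.lt_succ_iff] at hx hy hf hd
  have hd' : (m : ℤ) ∣ ρ j t' - ρ i t := (dvd_sub_comm).1 hd
  rcases le_total i j with hij | hij
  · obtain ⟨rfl, h1⟩ := key i hx.1 j hy.1 hij t hx.2 t' hy.2 hf hd
    obtain ⟨-, h2⟩ := key i hy.1 i hx.1 le_rfl t' hy.2 t hx.2 hf.symm hd'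
    rw [le_antisymm h2 h1]
  · obtain ⟨rfl, h1⟩ := key j hy.1 i hx.1 hij t' hy.2 t hx.2 hf.symm hd'
    obtain ⟨-, h2⟩ := key j hx.1 j hy.1 le_rfl t hx.2 t' hy.2 hf hd
    rw [le_antisymm h1 h2]

theorem card_le_of_link_same (h : F.Family P I γ γ' k f w) {J : Finset ℕ} (hJ : J ⊆ I) {m : ℕ}
    (hm : 0 < m) (ρ : ℕ → ℤ)
    (hl : ∀ i ∈ J, ∀ j ∈ J, (m : ℤ) ∣ ρ i - ρ j → ∃ κ ε, F.Link (γ i) (γ' j) κ ε) :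
    J.card ≤ m := by
  have := card_le_of_separated J (fun _ => ()) ρ hm ?_
  · simpa using this
  intro i hi j hj _ hd
  rcases le_total i j with hij | hij
  · obtain ⟨κ, ε, hε⟩ := hl i hi j hj hd
    exact (h.minimal i (hJ hi) j (hJ hj) hij _ _ hε).1
  · obtain ⟨κ, ε, hε⟩ := hl j hj i hi ((dvd_sub_comm).1 hd)
    exact (h.minimal j (hJ hj) i (hJ hi) hij _ _ hε).1.symm

open Classical in
theorem sum_start_le (h : F.Family P I γ γ' k f w) (S : Component E) :
    ∑ i ∈ I with component E (γ i).1 = S, (k i + 1) ≤ Fintype.card Q * F.a S := by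
  rcases (I.filter fun i => component E (γ i).1 = S).eq_empty_or_nonempty with he | ⟨i₀, h₀⟩
  · simp [he]
  rw [Finset.mem_filter] at h₀
  refine h.card_le_of_link (Finset.filter_subset _ _) (h₀.2 ▸ h.a_pos h₀.1)
    (fun i t => (γ i).2 + F.toC (γ i).1 + w i t) ?_
  intro i hi j hj t ht t' ht' hf hd
  rw [Finset.mem_filter] at hi hj
  refine ⟨_, h.link_start hi.1 hj.1 ht ht' (hi.2.trans hj.2.symm) hf ?_ hd⟩
  rw [hi.2]
  exact_mod_cast Nat.gcd_dvd_left _ _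

open Classical in
theorem sum_finish_le (h : F.Family P I γ γ' k f w) (T : Component E) :
    ∑ i ∈ I with component E (γ' i).1 = T, (k i + 1) ≤ Fintype.card Q * F.b T := by
  rcases (I.filter fun i => component E (γ' i).1 = T).eq_empty_or_nonempty with he | ⟨i₀, h₀⟩
  · simp [he]
  rw [Finset.mem_filter] at h₀
  refine h.card_le_of_link (Finset.filter_subset _ _) (h₀.2 ▸ h.b_pos h₀.1)
    (fun i t => (γ' i).2 - F.fromD (γ' i).1 - (w i (k i) - w i t)) ?_
  intro i hi j hj t ht t' ht' hf hd
  rw [Finset.mem_filter] at hi hj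
  refine ⟨_, h.link_finish hi.1 hj.1 ht ht' (hi.2.trans hj.2.symm) hf ?_ hd⟩
  rw [hj.2]
  exact_mod_cast Nat.gcd_dvd_right _ _

open Classical in
theorem card_start_le (h : F.Family P I γ γ' k f w) (S : Component E) :
    (I.filter fun i => component E (γ i).1 = S).card ≤ F.a S := by
  rcases (I.filter fun i => component E (γ i).1 = S).eq_empty_or_nonempty with he | ⟨i₀, h₀⟩
  · simp [he]
  rw [Finset.mem_filter] at h₀
  refine h.card_le_of_link_same (Finset.filter_subset _ _) (h₀.2 ▸ h.a_pos h₀.1)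
    (fun i => (γ i).2 + F.toC (γ i).1) ?_
  intro i hi j hj hd
  rw [Finset.mem_filter] at hi hj
  refine ⟨_, _, h.link_start (t := 0) (t' := 0) hi.1 hj.1 (Nat.zero_le _) (Nat.zero_le _)
    (hi.2.trans hj.2.symm) ?_ (g := F.a S) ?_ ?_⟩
  · rw [h.start i hi.1, h.start j hj.1, hi.2, hj.2]
  · rw [hi.2]
    exact_mod_cast Nat.gcd_dvd_left _ _
  · simpa [h.start_zero i hi.1, h.start_zero j hj.1] using hd

open Classical in
theorem card_finish_le (h : F.Family P I γ γ' k f w) (T : Component E) :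
    (I.filter fun i => component E (γ' i).1 = T).card ≤ F.b T := by
  rcases (I.filter fun i => component E (γ' i).1 = T).eq_empty_or_nonempty with he | ⟨i₀, h₀⟩
  · simp [he]
  rw [Finset.mem_filter] at h₀
  refine h.card_le_of_link_same (Finset.filter_subset _ _) (h₀.2 ▸ h.b_pos h₀.1)
    (fun i => (γ' i).2 - F.fromD (γ' i).1) ?_
  intro i hi j hj hd
  rw [Finset.mem_filter] at hi hj
  refine ⟨_, _, h.link_finish (t := k i) (t' := k j) hi.1 hj.1 le_rfl le_rfl
    (hi.2.trans hj.2.symm) ?_ (g := F.b T) ?_ ?_⟩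
  · rw [h.finish i hi.1, h.finish j hj.1, hi.2, hj.2]
  · rw [hj.2]
    exact_mod_cast Nat.gcd_dvd_right _ _
  · simpa using hd

-- All linking walks out of `S` start at the same vertex, so they can be spliced at position 0 once
-- the initial heights agree modulo the gcd.
open Classical in
theorem card_pair_le (h : F.Family P I γ γ' k f w) (S T : Component E) :
    (I.filter fun i => component E (γ i).1 = S ∧ component E (γ' i).1 = T).card ≤
      Nat.gcd (F.a S) (F.b T) := by
  rcases (I.filter fun i => component E (γ i).1 = S ∧
    component E (γ' i).1 = T).eq_empty_or_nonempty with he | ⟨i₀, h₀⟩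
  · simp [he]
  rw [Finset.mem_filter] at h₀
  refine h.card_le_of_link_same (Finset.filter_subset _ _)
    (Nat.gcd_pos_of_pos_left _ (h₀.2.1 ▸ h.a_pos h₀.1)) (fun i => (γ i).2 + F.toC (γ i).1) ?_
  intro i hi j hj hd
  rw [Finset.mem_filter] at hi hj
  refine ⟨_, _, h.link_start (t := 0) (t' := 0) hi.1 hj.1 (Nat.zero_le _) (Nat.zero_le _)
    (hi.2.1.trans hj.2.1.symm) ?_ (g := Nat.gcd (F.a S) (F.b T)) ?_ ?_⟩
  · rw [h.start i hi.1, h.start j hj.1, hi.2.1, hj.2.1]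
  · rw [hi.2.1, hj.2.2]
  · simpa [h.start_zero i hi.1, h.start_zero j hj.1] using hd

end Family

end Frame

/-! ### Pumping cycles at positive height -/

theorem exists_pump {a b : ℕ} (ha : 0 < a) (hb : 0 < b) {Δ : ℤ} (hg : (Nat.gcd a b : ℤ) ∣ Δ)
    {X : ℕ} (hΔ : |Δ| ≤ X) :
    ∃ x y : ℕ, (x * a - y * b : ℤ) = Δ ∧ X ≤ x * a ∧ a * x ≤ X + a * (b / Nat.gcd a b) ∧
      b * y ≤ 2 * X + b * (a / Nat.gcd a b) := by
  obtain ⟨a', ha'⟩ := Nat.gcd_dvd_left a b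
  obtain ⟨b', hb'⟩ := Nat.gcd_dvd_right a b
  have hbez := Nat.gcd_eq_gcd_ab a b
  have hgpos : 0 < Nat.gcd a b := Nat.gcd_pos_of_pos_left _ ha
  obtain ⟨q, hq⟩ := hg
  set g := Nat.gcd a b with hgdef
  have hb'pos : 0 < b' := Nat.pos_of_ne_zero (by rintro rfl; simp at hb'; omega)
  have hbg : b / g = b' := Nat.div_eq_of_eq_mul_right hgpos hb'
  have hag : a / g = a' := Nat.div_eq_of_eq_mul_right hgpos ha'
  have hab : a * b' = b * a' := by
    calc a * b' = (g * a') * b' := by rw [← ha']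
      _ = (g * b') * a' := by ring
      _ = b * a' := by rw [← hb']
  set c : ℕ := X / a + 1 with hc
  have hc1 : X ≤ c * a := by
    have := Nat.lt_div_mul_add (a := X) ha
    rw [hc, Nat.add_mul]; omega
  have hc2 : a * (c - 1) ≤ X := by
    rw [hc, Nat.add_sub_cancel]; exact Nat.mul_div_le X a
  set x₀ : ℤ := Nat.gcdA a b * q
  set u : ℤ := (x₀ - c) % b' with hu
  have hu0 : 0 ≤ u := Int.emod_nonneg _ (by omega)
  have hu1 : u < b' := Int.emod_lt_of_pos _ (by omega)
  obtain ⟨r, hr⟩ : (b' : ℤ) ∣ (x₀ - c) - u := Int.dvd_self_sub_emod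
  obtain ⟨v, hv⟩ := Int.eq_ofNat_of_zero_le hu0
  have hx : ((c + v : ℕ) : ℤ) = x₀ - b' * r := by push_cast; omega
  have hdvd : (b : ℤ) ∣ (c + v : ℕ) * a - Δ := by
    refine ⟨- Nat.gcdB a b * q - a' * r, ?_⟩
    have hab' : (a * b' : ℤ) = b * a' := by exact_mod_cast hab
    rw [hx, hq, hbez]
    linear_combination (-r) * hab'
  obtain ⟨y, hy⟩ := hdvd
  have hXx : X ≤ (c + v) * a := hc1.trans (Nat.mul_le_mul_right _ (by omega))
  rw [abs_le] at hΔ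
  have hy0 : 0 ≤ y := by
    have h1 : (0 : ℤ) ≤ b * y := by
      rw [← hy]
      have : (X : ℤ) ≤ (c + v : ℕ) * a := by exact_mod_cast hXx
      omega
    exact nonneg_of_mul_nonneg_right h1 (by exact_mod_cast hb)
  obtain ⟨y', rfl⟩ := Int.eq_ofNat_of_zero_le hy0
  have hxa : a * (c + v) ≤ X + a * b' := by
    calc a * (c + v) ≤ a * ((c - 1) + b') := Nat.mul_le_mul_left _ (by omega)
      _ = a * (c - 1) + a * b' := by ring
      _ ≤ _ := by omega
  refine ⟨c + v, y', ?_, hXx, ?_, ?_⟩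
  · linear_combination hy
  · rw [hbg]; exact hxa
  · rw [hag, ← hab]
    have h3 : ((a * (c + v) : ℕ) : ℤ) ≤ X + (a * b' : ℕ) := by exact_mod_cast hxa
    have h4 : ((b * y' : ℕ) : ℤ) = (a * (c + v) : ℕ) - Δ := by
      push_cast at hy ⊢; linear_combination -hy
    omega

/-- `PosRun E γ k γ'`: the graph with labelled edges `E` has a run from `γ` to `γ'` with `k` steps,
all of which are taken at a positive height. -/
inductive PosRun {Q : Type*} (E : Set (Q × ℤ × Q)) : Q × ℤ → ℕ → Q × ℤ → Prop
  | nil (γ : Q × ℤ) : PosRun E γ 0 γ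
  | cons {p q : Q} {d h : ℤ} {γ : Q × ℤ} {k : ℕ} (hd : (p, d, q) ∈ E) (hh : 0 < h)
      (hr : PosRun E (q, h + d) k γ) : PosRun E (p, h) (k + 1) γ

namespace PosRun

variable {Q : Type*} {E : Set (Q × ℤ × Q)}

theorem append {γ γ' γ'' : Q × ℤ} {k k' : ℕ} (h : PosRun E γ k γ') (h' : PosRun E γ' k' γ'') :
    PosRun E γ (k + k') γ'' := by
  induction h with
  | nil γ => simpa using h'
  | cons hd hh _ ih => rw [add_right_comm]; exact .cons hd hh (ih h')

theorem of_walk (hE : ∀ t ∈ E, |t.2.1| ≤ 1) {p q : Q} {k : ℕ} {e h : ℤ} (hw : Walk E p k e q)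
    (hh : k ≤ h) : PosRun E (p, h) k (q, h + e) := by
  induction hw generalizing h with
  | nil p => simpa using PosRun.nil (E := E) (p, h)
  | cons hd _ ih =>
    have := hE _ hd
    simp only [abs_le] at this
    push_cast at hh
    rw [← add_assoc]
    exact .cons hd (by omega) (ih (by omega))

theorem pump_up (hE : ∀ t ∈ E, |t.2.1| ≤ 1) {p : Q} {l a : ℕ} {h : ℤ} (hw : Walk E p l a p)
    (hh : l ≤ h) (x : ℕ) : PosRun E (p, h) (x * l) (p, h + x * a) := by
  induction x with
  | zero => simpa using PosRun.nil (E := E) (p, h)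
  | succ x ih =>
    have := ih.append (of_walk hE hw (h := h + x * a) (by have : (0 : ℤ) ≤ x * a := by positivity
                                                          omega))
    rw [Nat.succ_mul]
    convert this using 2
    push_cast; ring

theorem pump_down (hE : ∀ t ∈ E, |t.2.1| ≤ 1) {p : Q} {l b : ℕ} {h : ℤ}
    (hw : Walk E p l (-b) p) (hh : l ≤ h) (y : ℕ) : PosRun E (p, h + y * b) (y * l) (p, h) := by
  induction y with
  | zero => simpa using PosRun.nil (E := E) (p, h)
  | succ y ih =>
    have h1 := of_walk hE hw (h := h + (y + 1 : ℕ) * b)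
      (by have : (0 : ℤ) ≤ (y + 1 : ℕ) * b := by positivity
          omega)
    rw [show h + (y + 1 : ℕ) * b + -(b : ℤ) = h + y * b by push_cast; ring] at h1
    rw [Nat.succ_mul, add_comm (y * l)]
    exact h1.append ih

end PosRun

theorem compSize_le {Q : Type*} [Fintype Q] (E : Set (Q × ℤ × Q)) (S : Component E) :
    compSize E S ≤ Fintype.card Q :=
  (Finset.card_le_univ _)

/-! ### Total length of the runs that realise the jumps -/

namespace Frame.Family

variable {Q : Type*} [Fintype Q] {E : Set (Q × ℤ × Q)} {F : Frame E} {P : ℤ} {I : Finset ℕ}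
  {γ γ' : ℕ → Q × ℤ} {k : ℕ → ℕ} {f : ℕ → ℕ → Q} {w : ℕ → ℕ → ℤ}

/-- A source height of at least 2n pays for the walk to the cycle and for one round of it. The
effect to be compensated is at most `k i` for the linking walk plus n for each of the two connecting
walks and for the height window. Climbing by that much also keeps the linking walk positive. -/
theorem exists_run (hE : ∀ t ∈ E, |t.2.1| ≤ 1) (hP : 0 ≤ P) (h : F.Family P I γ γ' k f w)
    {i : ℕ} (hi : i ∈ I) {S T : Component E} (hS : component E (γ i).1 = S)
    (hT : component E (γ' i).1 = T) :
    ∃ x y len : ℕ, PosRun E (γ i) len (γ' i) ∧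
      len ≤ 2 * Fintype.card Q + (k i + (x * F.l S + y * F.m T)) ∧
      F.a S * x ≤ k i + 3 * Fintype.card Q + F.a S * (F.b T / Nat.gcd (F.a S) (F.b T)) ∧
      F.b T * y ≤ 2 * (k i + 3 * Fintype.card Q) + F.b T * (F.a S / Nat.gcd (F.a S) (F.b T)) := by
  obtain ⟨hup, hdn, h1, h2, -⟩ := h.jump i hi
  obtain ⟨k₁, hk₁, hw₁⟩ := F.toC_spec _ hup
  obtain ⟨k₂, hk₂, hw₂⟩ := F.fromD_spec _ hdn
  have hd := h.dvd i hi
  have hmid : Walk E (f i 0) (k i - 0) (w i (k i) - w i 0) (f i (k i)) :=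
    Walk.of_seq_le (Nat.zero_le _) (fun u _ hu => h.edge i hi u hu)
  rw [h.start i hi, h.start_zero i hi, h.finish i hi, sub_zero, Nat.sub_zero] at hmid
  have ha := h.a_pos hi
  have hb := h.b_pos hi
  have hC := (F.up _ hup).2.2
  have hD := (F.dn _ hdn).2.2
  rw [hS] at hw₁ hd hmid ha hC
  rw [hT] at hw₂ hd hmid hb hD
  have hl := (F.l_le S).trans (compSize_le E S)
  have hm := (F.m_le T).trans (compSize_le E T)
  have e₁ := hw₁.abs_effect_le hE
  have e₂ := hw₂.abs_effect_le hE
  have e₃ := hmid.abs_effect_le hE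
  rw [abs_le] at e₁ e₂ e₃
  obtain ⟨x, y, hxy, hX, hx, hy⟩ := exists_pump ha hb hd (X := k i + 3 * Fintype.card Q)
    (by rw [abs_le]; push_cast; omega)
  have hX' : ((k i + 3 * Fintype.card Q : ℕ) : ℤ) ≤ x * F.a S := by exact_mod_cast hX
  push_cast at hX'
  refine ⟨x, y, k₁ + (x * F.l S + (k i + (y * F.m T + k₂))), ?_, by omega, hx, hy⟩
  have r₁ := PosRun.of_walk hE hw₁ (h := (γ i).2) (by omega)
  have r₂ := PosRun.pump_up hE hC (h := (γ i).2 + F.toC (γ i).1) (by omega) x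
  have r₃ := PosRun.of_walk hE hmid (h := (γ i).2 + F.toC (γ i).1 + x * F.a S) (by omega)
  have r₄ := PosRun.pump_down hE hD (h := (γ' i).2 - F.fromD (γ' i).1) (by omega) y
  have r₅ := PosRun.of_walk hE hw₂ (h := (γ' i).2 - F.fromD (γ' i).1) (by omega)
  rw [show (γ i).2 + F.toC (γ i).1 + x * F.a S + w i (k i) =
    (γ' i).2 - F.fromD (γ' i).1 + y * F.b T by linear_combination hxy] at r₃
  rw [sub_add_cancel] at r₅
  exact r₁.append (r₂.append (r₃.append (r₄.append r₅)))

-- At most gcd(a_S, b_T) jumps lead from S to T, and each contributes b_T / gcd(a_S, b_T). So T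
-- contributes at most b_T ≤ |T|.
open Classical in
theorem sum_div_start_le (h : F.Family P I γ γ' k f w) (S : Component E) :
    ∑ i ∈ I with component E (γ i).1 = S, F.b (component E (γ' i).1) /
      Nat.gcd (F.a S) (F.b (component E (γ' i).1)) ≤ Fintype.card Q := by
  rw [← Finset.sum_fiberwise _ (fun i => component E (γ' i).1), ← sum_compSize E]
  refine Finset.sum_le_sum fun T _ => le_trans ?_ (F.b_le T)
  rw [Finset.filter_filter, Finset.sum_congr rfl (g := fun _ => F.b T / Nat.gcd (F.a S) (F.b T))
    (by intro i hi; rw [(Finset.mem_filter.1 hi).2.2]), Finset.sum_const, smul_eq_mul]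
  exact (Nat.mul_le_mul_right _ (h.card_pair_le S T)).trans (Nat.mul_div_le _ _)

open Classical in
theorem sum_div_finish_le (h : F.Family P I γ γ' k f w) (T : Component E) :
    ∑ i ∈ I with component E (γ' i).1 = T, F.a (component E (γ i).1) /
      Nat.gcd (F.a (component E (γ i).1)) (F.b T) ≤ Fintype.card Q := by
  rw [← Finset.sum_fiberwise _ (fun i => component E (γ i).1), ← sum_compSize E]
  refine Finset.sum_le_sum fun S _ => le_trans ?_ (F.a_le S)
  rw [Finset.filter_filter, Finset.sum_congr rfl (g := fun _ => F.a S / Nat.gcd (F.a S) (F.b T))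
    (by intro i hi; rw [(Finset.mem_filter.1 hi).2.2]), Finset.sum_const, smul_eq_mul]
  refine (Nat.mul_le_mul_right _ ?_).trans (Nat.mul_div_le _ (Nat.gcd (F.a S) (F.b T)))
  simpa only [and_comm] using h.card_pair_le S T

-- After multiplication by a_S the three terms are bounded by n·a_S (positions on linking walks),
-- 3n·a_S (at most a_S jumps) and n·a_S (the quotients), so a_S cancels.
open Classical in
theorem sum_up_le (h : F.Family P I γ γ' k f w) {x : ℕ → ℕ}
    (hx : ∀ i ∈ I, F.a (component E (γ i).1) * x i ≤ k i + 3 * Fintype.card Q +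
      F.a (component E (γ i).1) * (F.b (component E (γ' i).1) /
        Nat.gcd (F.a (component E (γ i).1)) (F.b (component E (γ' i).1)))) (S : Component E) :
    ∑ i ∈ I with component E (γ i).1 = S, x i ≤ 5 * Fintype.card Q := by
  rcases (I.filter fun i => component E (γ i).1 = S).eq_empty_or_nonempty with he | ⟨i₀, h₀⟩
  · simp [he]
  rw [Finset.mem_filter] at h₀
  have ha : 0 < F.a S := h₀.2 ▸ h.a_pos h₀.1
  refine Nat.le_of_mul_le_mul_left ?_ ha
  rw [Finset.mul_sum]
  calc ∑ i ∈ I with component E (γ i).1 = S, F.a S * x i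
      ≤ ∑ i ∈ I with component E (γ i).1 = S, ((k i + 1) + 3 * Fintype.card Q + F.a S *
        (F.b (component E (γ' i).1) / Nat.gcd (F.a S) (F.b (component E (γ' i).1)))) := by
        refine Finset.sum_le_sum fun i hi => ?_
        rw [Finset.mem_filter] at hi
        have := hx i hi.1
        rw [hi.2] at this
        omega
    _ ≤ Fintype.card Q * F.a S + F.a S * (3 * Fintype.card Q) + F.a S * Fintype.card Q := by
        rw [Finset.sum_add_distrib, Finset.sum_add_distrib, Finset.sum_const, smul_eq_mul,
          ← Finset.mul_sum]
        gcongr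
        · exact h.sum_start_le S
        · exact h.card_start_le S
        · exact h.sum_div_start_le S
    _ = F.a S * (5 * Fintype.card Q) := by ring

open Classical in
theorem sum_down_le (h : F.Family P I γ γ' k f w) {y : ℕ → ℕ}
    (hy : ∀ i ∈ I, F.b (component E (γ' i).1) * y i ≤ 2 * (k i + 3 * Fintype.card Q) +
      F.b (component E (γ' i).1) * (F.a (component E (γ i).1) /
        Nat.gcd (F.a (component E (γ i).1)) (F.b (component E (γ' i).1)))) (T : Component E) :
    ∑ i ∈ I with component E (γ' i).1 = T, y i ≤ 9 * Fintype.card Q := by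
  rcases (I.filter fun i => component E (γ' i).1 = T).eq_empty_or_nonempty with he | ⟨i₀, h₀⟩
  · simp [he]
  rw [Finset.mem_filter] at h₀
  have hb : 0 < F.b T := h₀.2 ▸ h.b_pos h₀.1
  refine Nat.le_of_mul_le_mul_left ?_ hb
  rw [Finset.mul_sum]
  calc ∑ i ∈ I with component E (γ' i).1 = T, F.b T * y i
      ≤ ∑ i ∈ I with component E (γ' i).1 = T, (2 * (k i + 1) + 6 * Fintype.card Q + F.b T *
        (F.a (component E (γ i).1) / Nat.gcd (F.a (component E (γ i).1)) (F.b T))) := by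
        refine Finset.sum_le_sum fun i hi => ?_
        rw [Finset.mem_filter] at hi
        have := hy i hi.1
        rw [hi.2] at this
        omega
    _ ≤ 2 * (Fintype.card Q * F.b T) + F.b T * (6 * Fintype.card Q) + F.b T * Fintype.card Q := by
        rw [Finset.sum_add_distrib, Finset.sum_add_distrib, Finset.sum_const, smul_eq_mul,
          ← Finset.mul_sum, ← Finset.mul_sum]
        gcongr
        · exact h.sum_finish_le T
        · exact h.card_finish_le T
        · exact h.sum_div_finish_le T
    _ = F.b T * (9 * Fintype.card Q) := by ring

theorem card_le (h : F.Family P I γ γ' k f w) : I.card ≤ Fintype.card Q := by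
  classical
  rw [Finset.card_eq_sum_card_fiberwise (f := fun i => component E (γ i).1) (t := Finset.univ)
    (by simp), ← sum_compSize E]
  exact Finset.sum_le_sum fun S _ => (h.card_start_le S).trans (F.a_le S)

theorem sum_length_le (h : F.Family P I γ γ' k f w) :
    ∑ i ∈ I, k i ≤ Fintype.card Q * Fintype.card Q := by
  classical
  rw [← Finset.sum_fiberwise _ (fun i => component E (γ i).1)]
  calc _ ≤ ∑ S, Fintype.card Q * compSize E S := by
        refine Finset.sum_le_sum fun S _ => ?_
        refine le_trans ?_ ((h.sum_start_le S).trans (Nat.mul_le_mul_left _ (F.a_le S)))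
        exact Finset.sum_le_sum fun i _ => Nat.le_succ _
    _ = _ := by rw [← Finset.mul_sum, sum_compSize]

end Frame.Family

/-- A family of jumps none of which can be merged with a later one can be realised by runs of
total length at most quadratic in the number of vertices. -/
theorem Frame.exists_runs {Q : Type*} [Fintype Q] {E : Set (Q × ℤ × Q)}
    (hE : ∀ t ∈ E, |t.2.1| ≤ 1) (F : Frame E) {P : ℤ} (hP : 0 ≤ P) (I : Finset ℕ)
    (γ γ' : ℕ → Q × ℤ) (hJ : ∀ i ∈ I, F.Jump P (γ i) (γ' i))
    (hno : ∀ i ∈ I, ∀ j ∈ I, i < j → ¬ F.Jump P (γ i) (γ' j)) :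
    ∃ len : ℕ → ℕ, (∀ i ∈ I, PosRun E (γ i) (len i) (γ' i)) ∧
      ∑ i ∈ I, len i ≤ 17 * Fintype.card Q ^ 2 := by
  classical
  obtain ⟨k, f, w, h⟩ := F.exists_family P I γ γ' hJ hno
  have := fun i (hi : i ∈ I) => h.exists_run hE hP hi rfl rfl
  choose! x y len h1 h2 h3 h4 using this
  refine ⟨len, h1, ?_⟩
  have hx : ∑ i ∈ I, x i * F.l (component E (γ i).1) ≤ 5 * Fintype.card Q * Fintype.card Q := by
    rw [← Finset.sum_fiberwise _ (fun i => component E (γ i).1)]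
    calc _ ≤ ∑ S, 5 * Fintype.card Q * compSize E S := by
          refine Finset.sum_le_sum fun S _ => ?_
          rw [Finset.sum_congr rfl (g := fun i => x i * F.l S)
            (by intro i hi; rw [(Finset.mem_filter.1 hi).2]), ← Finset.sum_mul]
          exact Nat.mul_le_mul (h.sum_up_le h3 S) (F.l_le S)
      _ = _ := by rw [← Finset.mul_sum, sum_compSize]
  have hy : ∑ i ∈ I, y i * F.m (component E (γ' i).1) ≤ 9 * Fintype.card Q * Fintype.card Q := by
    rw [← Finset.sum_fiberwise _ (fun i => component E (γ' i).1)]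
    calc _ ≤ ∑ T, 9 * Fintype.card Q * compSize E T := by
          refine Finset.sum_le_sum fun T _ => ?_
          rw [Finset.sum_congr rfl (g := fun i => y i * F.m T)
            (by intro i hi; rw [(Finset.mem_filter.1 hi).2]), ← Finset.sum_mul]
          exact Nat.mul_le_mul (h.sum_down_le h4 T) (F.m_le T)
      _ = _ := by rw [← Finset.mul_sum, sum_compSize]
  have hc : I.card * (2 * Fintype.card Q) ≤ Fintype.card Q * (2 * Fintype.card Q) :=
    Nat.mul_le_mul_right _ h.card_le
  have hk := h.sum_length_le
  have hs := Finset.sum_le_sum h2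
  simp only [Finset.sum_add_distrib, Finset.sum_const, smul_eq_mul] at hs
  -- The summands are 2n² for connecting walks, n² for linking walks, 5n² for pumping up and 9n² for
  -- pumping down.
  nlinarith

/-! ### Shortest sequences and repeated states -/

/-- A shortest path in a relation has no shortcuts and no repetitions. -/
theorem exists_shortest_seq {α : Type*} {r : α → α → Prop} {a b : α}
    (h : Relation.ReflTransGen r a b) :
    ∃ (L : ℕ) (f : ℕ → α), f 0 = a ∧ f L = b ∧ (∀ i < L, r (f i) (f (i + 1))) ∧
      (∀ i j, i < j → j < L → ¬ r (f i) (f (j + 1))) ∧ ∀ i j, i < j → j ≤ L → f i ≠ f j := by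
  classical
  have hex : ∃ (L : ℕ) (f : ℕ → α), f 0 = a ∧ f L = b ∧ ∀ i < L, r (f i) (f (i + 1)) := by
    induction h using Relation.ReflTransGen.head_induction_on with
    | refl => exact ⟨0, fun _ => b, rfl, rfl, by simp⟩
    | @head a c hac _ ih =>
      obtain ⟨L, f, h0, h1, h2⟩ := ih
      refine ⟨L + 1, fun t => Nat.casesOn t a f, rfl, h1, ?_⟩
      intro i hi
      cases i with
      | zero => simpa [h0] using hac
      | succ i => simpa using h2 i (by omega)
  obtain ⟨f, h0, h1, h2⟩ := Nat.find_spec hex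
  have hshort : ∀ i j, i < j → j < Nat.find hex → ¬ r (f i) (f (j + 1)) := by
    intro i j hij hj hr
    refine Nat.find_min hex (m := Nat.find hex - (j - i)) (by omega)
      ⟨fun t => if t ≤ i then f t else f (t + (j - i)), by simp [h0], ?_, ?_⟩
    · simp only
      rw [if_neg (by omega), Nat.sub_add_cancel (by omega), h1]
    · intro t ht
      simp only
      rcases lt_trichotomy t i with h | rfl | h
      · rw [if_pos h.le, if_pos (by omega)]
        exact h2 t (by omega)
      · rw [if_pos le_rfl, if_neg (by omega), show t + 1 + (j - t) = j + 1 by omega]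
        exact hr
      · rw [if_neg (by omega), if_neg (by omega), add_right_comm]
        exact h2 _ (by omega)
  refine ⟨_, f, h0, h1, h2, hshort, ?_⟩
  intro i j hij hj hf
  rcases hj.lt_or_eq with hj | rfl
  · exact hshort i j hij hj (hf ▸ h2 j hj)
  · exact Nat.find_min hex hij ⟨f, h0, hf.trans h1, fun t ht => h2 t (by omega)⟩

/-- A sequence that climbs by as many levels as there are states repeats a state at two
different levels, in increasing order. -/
theorem exists_repeat_up {Q : Type*} [Fintype Q] (q : ℕ → Q) {h : ℕ → ℤ} {A B : ℕ} {lo : ℤ}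
    (hstep : ∀ i, A ≤ i → i < B → h (i + 1) ≤ h i + 1) (hAB : A ≤ B) (hA : h A ≤ lo)
    (hB : lo + Fintype.card Q ≤ h B) :
    ∃ i j, A ≤ i ∧ i < j ∧ j ≤ B ∧ q i = q j ∧ lo ≤ h i ∧ h i < h j ∧
      h j ≤ lo + Fintype.card Q := by
  classical
  -- Unit steps skip no level, so each of the n + 1 levels has a first time at which it is reached,
  -- and two of these times share a state.
  have hfirst : ∀ v : Fin (Fintype.card Q + 1), ∃ i, A ≤ i ∧ i ≤ B ∧ h i = lo + (v : ℕ) ∧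
      ∀ j, A ≤ j → lo + (v : ℕ) ≤ h j → i ≤ j := by
    intro v
    have hv := v.2
    have hex : ∃ i, A ≤ i ∧ lo + (v : ℕ) ≤ h i := ⟨B, hAB, by omega⟩
    obtain ⟨h1, h2⟩ := Nat.find_spec hex
    have hleB : Nat.find hex ≤ B := Nat.find_min' hex ⟨hAB, by omega⟩
    refine ⟨_, h1, hleB, le_antisymm ?_ h2, fun j hj hj' => Nat.find_min' hex ⟨hj, hj'⟩⟩
    rcases h1.eq_or_lt with he | hlt
    · rw [← he]; omega
    · obtain ⟨i, hi⟩ : ∃ i, Nat.find hex = i + 1 := ⟨Nat.find hex - 1, by omega⟩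
      have hlow : h i < lo + (v : ℕ) := by
        by_contra! hge
        exact Nat.find_min hex (m := i) (by omega) ⟨by omega, hge⟩
      have := hstep i (by omega) (by omega)
      rw [hi]; omega
  choose g h1 h2 h3 h4 using hfirst
  obtain ⟨x, y, hxy, hq⟩ := Fintype.exists_ne_map_eq_of_card_lt (fun v => q (g v)) (by simp)
  wlog hlt : x < y generalizing x y
  · exact this y x hxy.symm hq.symm (lt_of_le_of_ne (not_lt.1 hlt) hxy.symm)
  have hlt' : (x : ℕ) < y := hlt
  have hy := y.2
  have e1 := h3 x
  have e2 := h3 y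
  refine ⟨g x, g y, h1 x, lt_of_le_of_ne (h4 x _ (h1 y) (by omega)) ?_, h2 y, hq, by omega,
    by omega, by omega⟩
  intro he
  rw [he] at e1
  omega

/-- A sequence that descends by as many levels as there are states repeats a state at two
different levels, in decreasing order. -/
theorem exists_repeat_down {Q : Type*} [Fintype Q] (q : ℕ → Q) {h : ℕ → ℤ} {A B : ℕ} {lo : ℤ}
    (hstep : ∀ i, A ≤ i → i < B → h i ≤ h (i + 1) + 1) (hAB : A ≤ B) (hB : h B ≤ lo)
    (hA : lo + Fintype.card Q ≤ h A) :
    ∃ i j, A ≤ i ∧ i < j ∧ j ≤ B ∧ q i = q j ∧ lo ≤ h j ∧ h j < h i ∧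
      h i ≤ lo + Fintype.card Q := by
  obtain ⟨i, j, h1, h2, h3, h4, h5, h6, h7⟩ := exists_repeat_up (fun t => q (A + B - t))
    (h := fun t => h (A + B - t)) (A := A) (B := B) (lo := lo) (by
      intro i hi hi'
      have := hstep (A + B - (i + 1)) (by omega) (by omega)
      rwa [show A + B - (i + 1) + 1 = A + B - i by omega] at this) hAB (by simpa using hB)
      (by simpa using hA)
  exact ⟨A + B - j, A + B - i, by omega, by omega, by omega, h4.symm, h5, h6, h7⟩

/-! ### From high excursions to jumps -/

namespace Frame

variable {Q : Type*} [Fintype Q] {E : Set (Q × ℤ × Q)}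

/-- With a - 1 extra rounds of the closed walk c → s → c the effect becomes a(e + `toC s`) - `toC
s`, which cancels `toC s` modulo a. -/
theorem exists_walk_fromC (F : Frame E) {s : Q} (hs : HasCycle E 1 (component E s)) :
    ∃ k e, Walk E (F.c (component E s)) k e s ∧
      (F.a (component E s) : ℤ) ∣ e + F.toC s := by
  obtain ⟨h1, h2, -⟩ := F.up _ hs
  obtain ⟨⟨_, e, hw⟩, -⟩ := component_eq_iff.1 h1
  obtain ⟨_, -, hw'⟩ := F.toC_spec s hs
  refine ⟨_, _, ((hw.append hw').pow (F.a (component E s) - 1)).append hw, e + F.toC s, ?_⟩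
  rw [Nat.cast_sub (by omega)]
  push_cast; ring

theorem exists_walk_toD (F : Frame E) {s : Q} (hs : HasCycle E (-1) (component E s)) :
    ∃ k e, Walk E s k e (F.d (component E s)) ∧
      (F.b (component E s) : ℤ) ∣ e + F.fromD s := by
  obtain ⟨h1, h2, -⟩ := F.dn _ hs
  obtain ⟨-, ⟨_, e, hw⟩⟩ := component_eq_iff.1 h1
  obtain ⟨_, -, hw'⟩ := F.fromD_spec s hs
  refine ⟨_, _, hw.append ((hw'.append hw).pow (F.b (component E s) - 1)), e + F.fromD s, ?_⟩
  rw [Nat.cast_sub (by omega)]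
  push_cast; ring

theorem jump_of_walk (F : Frame E) {P : ℤ} {γ γ' : Q × ℤ}
    (hup : HasCycle E 1 (component E γ.1)) (hdn : HasCycle E (-1) (component E γ'.1))
    (h1 : P + 2 * Fintype.card Q ≤ γ.2 ∧ γ.2 ≤ P + 3 * Fintype.card Q)
    (h2 : P + 2 * Fintype.card Q ≤ γ'.2 ∧ γ'.2 ≤ P + 3 * Fintype.card Q) {k : ℕ}
    (hw : Walk E γ.1 k (γ'.2 - γ.2) γ'.1) : F.Jump P γ γ' := by
  obtain ⟨k₁, e₁, hw₁, hd₁⟩ := F.exists_walk_fromC hup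
  obtain ⟨k₂, e₂, hw₂, hd₂⟩ := F.exists_walk_toD hdn
  refine ⟨hup, hdn, h1, h2, _, _, hw₁.append (hw.append hw₂), ?_⟩
  have g₁ : (Nat.gcd (F.a (component E γ.1)) (F.b (component E γ'.1)) : ℤ) ∣ e₁ + F.toC γ.1 :=
    dvd_trans (by exact_mod_cast Nat.gcd_dvd_left _ _) hd₁
  have g₂ : (Nat.gcd (F.a (component E γ.1)) (F.b (component E γ'.1)) : ℤ) ∣ e₂ + F.fromD γ'.1 :=
    dvd_trans (by exact_mod_cast Nat.gcd_dvd_right _ _) hd₂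
  refine ((dvd_add g₁ g₂).neg_right).trans (dvd_of_eq ?_)
  ring

/-- An excursion above the level `P` either stays low, or its high part is a jump. -/
theorem excursion (hE : ∀ t ∈ E, |t.2.1| ≤ 1) (F : Frame E) {P : ℤ} (g : ℕ → Q × ℤ)
    {A B : ℕ} (hAB : A ≤ B) (hA : (g A).2 ≤ P) (hB : (g B).2 ≤ P)
    (hst : ∀ i, A ≤ i → i < B → |(g (i + 1)).2 - (g i).2| ≤ 1)
    (hedge : ∀ i, A < i → i < B → ((g i).1, (g (i + 1)).2 - (g i).2, (g (i + 1)).1) ∈ E) :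
    (∀ i, A ≤ i → i ≤ B → (g i).2 ≤ P + 3 * Fintype.card Q) ∨
    ∃ τ τ', A < τ ∧ τ < τ' ∧ τ' < B ∧ F.Jump P (g τ) (g τ') ∧
      (∀ i, A ≤ i → i ≤ τ → (g i).2 ≤ P + 3 * Fintype.card Q) ∧
      ∀ i, τ' ≤ i → i ≤ B → (g i).2 ≤ P + 3 * Fintype.card Q := by
  classical
  have hn : 0 < Fintype.card Q := Fintype.card_pos_iff.2 ⟨(g 0).1⟩
  rw [or_iff_not_imp_left]
  intro hnot
  push Not at hnot
  obtain ⟨v, hv1, hv2, hv3⟩ := hnot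
  have hex : ∃ i, A ≤ i ∧ P + 3 * Fintype.card Q < (g i).2 := ⟨v, hv1, hv3⟩
  obtain ⟨u, hu⟩ : ∃ u, u = Nat.find hex := ⟨_, rfl⟩
  obtain ⟨hu1, hu2⟩ := Nat.find_spec hex
  have huv : Nat.find hex ≤ v := Nat.find_min' hex ⟨hv1, hv3⟩
  have humin : ∀ i, A ≤ i → i < u → (g i).2 ≤ P + 3 * Fintype.card Q := by
    intro i hi hi'
    by_contra! hlt
    exact Nat.find_min hex (m := i) (by omega) ⟨hi, hlt⟩
  rw [← hu] at hu1 hu2 huv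
  set W := Nat.findGreatest (fun i => P + 3 * Fintype.card Q < (g i).2) B with hW
  have hW1 : P + 3 * Fintype.card Q < (g W).2 :=
    Nat.findGreatest_spec (P := fun i => P + 3 * Fintype.card Q < (g i).2) hv2 hv3
  have hWB : W ≤ B := Nat.findGreatest_le _
  have hvW : v ≤ W := Nat.le_findGreatest hv2 hv3
  have hWmax : ∀ i, W < i → i ≤ B → (g i).2 ≤ P + 3 * Fintype.card Q := by
    intro i hi hi'
    exact not_lt.1 (Nat.findGreatest_is_greatest hi hi')
  -- The climb before the first time `u` above P + 3n and the descent after the last such time `W`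
  -- both cross the window from P + 2n to P + 3n.
  obtain ⟨i, j, a1, a2, a3, a4, a5, a6, a7⟩ := exists_repeat_up (fun t => (g t).1)
    (h := fun t => (g t).2) (A := A) (B := u) (lo := P + 2 * Fintype.card Q) (by
      intro i hi hi'
      have := hst i hi (by omega)
      rw [abs_le] at this
      omega) hu1 (by omega) (by omega)
  obtain ⟨i', j', b1, b2, b3, b4, b5, b6, b7⟩ := exists_repeat_down (fun t => (g t).1)
    (h := fun t => (g t).2) (A := W) (B := B) (lo := P + 2 * Fintype.card Q) (by
      intro i hi hi'
      have := hst i (by omega) (by omega)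
      rw [abs_le] at this
      omega) hWB (by omega) (by omega)
  have hju : j ≠ u := by rintro rfl; omega
  -- The step out of `A` need not be an edge of `E`; the window lies strictly above the height of
  -- `A`.
  have hiA : i ≠ A := by rintro rfl; omega
  have hjB : j' ≠ B := by rintro rfl; omega
  have key : ∀ x y, A < x → x ≤ y → y ≤ B →
      Walk E (g x).1 (y - x) ((g y).2 - (g x).2) (g y).1 := fun x y hx hxy hy =>
    Walk.of_seq_le (f := fun t => (g t).1) (w := fun t => (g t).2) hxy
      (fun t ht ht' => hedge t (by omega) (by omega))
  have c1 := key i j (by omega) a2.le (by omega)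
  have c2 := key i' j' (by omega) b2.le (by omega)
  rw [← a4] at c1
  rw [b4] at c2
  refine ⟨i, j', by omega, by omega, by omega, ?_, fun t ht ht' => humin t ht (by omega),
    fun t ht ht' => hWmax t (by omega) ht'⟩
  exact F.jump_of_walk (exists_isCycle hE (by simp) c1 (by omega))
    (exists_isCycle hE (by simp) c2 (by omega)) (by omega) (by omega)
    (key i j' (by omega) (by omega) (by omega))

end Frame

/-! ### Counter systems, their mirror images and macro steps -/

namespace ZOCS

variable {Q : Type*}

/-- The graph of the negative transitions, with the signs of the effects changed. -/
def negGraph (O : ZOCS Q) : Set (Q × ℤ × Q) := {t | (t.1, -t.2.1, t.2.2) ∈ O.neg}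

/-- Change of the sign of the counter. -/
def mirror (γ : Q × ℤ) : Q × ℤ := (γ.1, -γ.2)

theorem abs_pos_le (O : ZOCS Q) : ∀ t ∈ O.pos, |t.2.1| ≤ 1 := by
  intro t ht
  have := O.pos_eff t ht
  simp only [Set.mem_insert_iff, Set.mem_singleton_iff] at this
  rw [abs_le]; omega

theorem abs_negGraph_le (O : ZOCS Q) : ∀ t ∈ O.negGraph, |t.2.1| ≤ 1 := by
  intro t ht
  have := O.neg_eff _ ht
  simp only [Set.mem_insert_iff, Set.mem_singleton_iff] at this
  rw [abs_le]; omega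

theorem Fires.abs_le {O : ZOCS Q} {γ γ' : Q × ℤ} {t : Q × ℤ × Q} (h : O.Fires γ t γ') :
    |γ'.2 - γ.2| ≤ 1 := by
  obtain ⟨⟨-, h⟩, rfl⟩ := h
  have : t.2.1 ∈ ({-1, 0, 1} : Set ℤ) := by
    rcases h with h | h | h
    · exact O.pos_eff t h.1
    · exact O.neg_eff t h.1
    · exact O.zero_eff t h.1
  simp only [Set.mem_insert_iff, Set.mem_singleton_iff] at this
  rw [_root_.abs_le]
  dsimp only
  omega

theorem Fires.mem_pos {O : ZOCS Q} {γ γ' : Q × ℤ} {t : Q × ℤ × Q} (h : O.Fires γ t γ')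
    (hγ : 0 < γ.2) : (γ.1, γ'.2 - γ.2, γ'.1) ∈ O.pos := by
  obtain ⟨⟨h1, h⟩, rfl⟩ := h
  rcases h with h | h | h
  · simpa [h1] using h.1
  · omega
  · omega

theorem Fires.mem_negGraph {O : ZOCS Q} {γ γ' : Q × ℤ} {t : Q × ℤ × Q} (h : O.Fires γ t γ')
    (hγ : γ.2 < 0) :
    ((mirror γ).1, (mirror γ').2 - (mirror γ).2, (mirror γ').1) ∈ O.negGraph := by
  obtain ⟨⟨h1, h⟩, rfl⟩ := h
  rcases h with h | h | h
  · omega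
  · simpa [h1, negGraph, mirror] using h.1
  · omega

theorem IsPath.append {O : ZOCS Q} {α β γ : Q × ℤ} {ρ ρ' : List ((Q × ℤ) × (Q × ℤ × Q))}
    (h : O.IsPath α ρ β) (h' : O.IsPath β ρ' γ) : O.IsPath α (ρ ++ ρ') γ := by
  induction h with
  | nil α => exact h'
  | cons hf _ ih => exact .cons hf (ih h')

theorem exists_isPath_of_posRun {O : ZOCS Q} {γ γ' : Q × ℤ} {k : ℕ} (h : PosRun O.pos γ k γ') :
    ∃ ρ, O.IsPath γ ρ γ' ∧ ρ.length = k := by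
  induction h with
  | nil γ => exact ⟨[], .nil γ, rfl⟩
  | @cons p q d h γ k hd hh _ ih =>
    obtain ⟨ρ, h1, h2⟩ := ih
    exact ⟨_, .cons (t := (p, d, q)) ⟨⟨rfl, .inl ⟨hd, hh⟩⟩, rfl⟩ h1, by simp [h2]⟩

theorem exists_isPath_of_posRun_mirror {O : ZOCS Q} {γ γ' : Q × ℤ} {k : ℕ}
    (h : PosRun O.negGraph γ k γ') :
    ∃ ρ, O.IsPath (mirror γ) ρ (mirror γ') ∧ ρ.length = k := by
  induction h with
  | nil γ => exact ⟨[], .nil _, rfl⟩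
  | @cons p q d h γ k hd hh _ ih =>
    obtain ⟨ρ, h1, h2⟩ := ih
    refine ⟨_, .cons (t := (p, -d, q)) ⟨⟨rfl, .inr (.inl ⟨hd, ?_⟩)⟩, ?_⟩ h1, by simp [h2]⟩
    · simpa [mirror] using hh
    · simp [mirror, add_comm]

theorem IsPath.exists_seq {O : ZOCS Q} {α β : Q × ℤ} {ρ : List ((Q × ℤ) × (Q × ℤ × Q))}
    (h : O.IsPath α ρ β) : ∃ (m : ℕ) (g : ℕ → Q × ℤ), g 0 = α ∧ g m = β ∧
      ∀ i < m, ∃ t, O.Fires (g i) t (g (i + 1)) := by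
  induction h with
  | nil α => exact ⟨0, fun _ => α, rfl, rfl, by simp⟩
  | @cons α γ β t ρ hf _ ih =>
    obtain ⟨m, g, h1, h2, h3⟩ := ih
    refine ⟨m + 1, fun t => Nat.casesOn t α g, rfl, h2, ?_⟩
    intro i hi
    cases i with
    | zero => exact ⟨t, by simpa [h1] using hf⟩
    | succ i => simpa using h3 i (by omega)

theorem exists_isPath_of_seq {O : ZOCS Q} {f : ℕ → Q × ℤ} {cost : ℕ → ℕ} (L : ℕ)
    (h : ∀ i < L, ∃ ρ, O.IsPath (f i) ρ (f (i + 1)) ∧ ρ.length ≤ cost i) :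
    ∃ ρ, O.IsPath (f 0) ρ (f L) ∧ ρ.length ≤ ∑ i ∈ Finset.range L, cost i := by
  induction L with
  | zero => exact ⟨[], .nil _, by simp⟩
  | succ L ih =>
    obtain ⟨ρ, h1, h2⟩ := ih (fun i hi => h i (by omega))
    obtain ⟨ρ', h3, h4⟩ := h L (by omega)
    refine ⟨ρ ++ ρ', h1.append h3, ?_⟩
    rw [Finset.sum_range_succ, List.length_append]
    omega

variable [Fintype Q]

/-- The counter value of `γ` is at distance at most `3 * n` from the interval from `-N` to `P`. -/
def InZone (P N : ℤ) (γ : Q × ℤ) : Prop :=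
  -N - 3 * Fintype.card Q ≤ γ.2 ∧ γ.2 ≤ P + 3 * Fintype.card Q

/-- A step of the system or a jump, positive or negative, between configurations whose counter
values are not far from the interval from `-N` to `P`. -/
def MacroStep (O : ZOCS Q) (F : Frame O.pos) (G : Frame O.negGraph) (P N : ℤ) (γ γ' : Q × ℤ) :
    Prop :=
  InZone P N γ ∧ InZone P N γ' ∧
    ((∃ t, O.Fires γ t γ') ∨ F.Jump P γ γ' ∨ G.Jump N (mirror γ) (mirror γ'))

theorem macroReachable_of_low {O : ZOCS Q} (F : Frame O.pos) (G : Frame O.negGraph) {P N : ℤ}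
    {g : ℕ → Q × ℤ} {A B : ℕ} (hAB : A ≤ B)
    (hg : ∀ i, A ≤ i → i < B → ∃ t, O.Fires (g i) t (g (i + 1)))
    (hz : ∀ i, A ≤ i → i ≤ B → InZone P N (g i)) :
    Relation.ReflTransGen (O.MacroStep F G P N) (g A) (g B) := by
  induction B, hAB using Nat.le_induction with
  | base => exact .refl
  | succ B hAB ih =>
    exact (ih (fun i h1 h2 => hg i h1 (by omega)) (fun i h1 h2 => hz i h1 (by omega))).tail
      ⟨hz B hAB (by omega), hz _ (by omega) le_rfl, .inl (hg B hAB (by omega))⟩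

/-- The path is cut at its visits to the interval from `-N` to `P`. Between consecutive visits it
stays on one side, since unit steps cannot cross the interval unseen, and `Frame.excursion` applies
to that part or to its mirror image. -/
theorem macroReachable {O : ZOCS Q} (F : Frame O.pos) (G : Frame O.negGraph) {P N : ℤ}
    (hP : 0 ≤ P) (hN : 0 ≤ N) {g : ℕ → Q × ℤ} {m : ℕ}
    (hg : ∀ i < m, ∃ t, O.Fires (g i) t (g (i + 1))) (h0 : -N ≤ (g 0).2 ∧ (g 0).2 ≤ P) (s : ℕ)
    (hs : s ≤ m) (hsr : -N ≤ (g s).2 ∧ (g s).2 ≤ P) :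
    Relation.ReflTransGen (O.MacroStep F G P N) (g 0) (g s) := by
  classical
  induction s using Nat.strong_induction_on with
  | _ s ih =>
  rcases Nat.eq_zero_or_pos s with rfl | hpos
  · exact .refl
  set A := Nat.findGreatest (fun i => -N ≤ (g i).2 ∧ (g i).2 ≤ P) (s - 1) with hAdef
  have hA : -N ≤ (g A).2 ∧ (g A).2 ≤ P :=
    Nat.findGreatest_spec (P := fun i => -N ≤ (g i).2 ∧ (g i).2 ≤ P) (Nat.zero_le _) h0
  have hAs : A ≤ s - 1 := Nat.findGreatest_le _
  have hout : ∀ i, A < i → i < s → ¬ (-N ≤ (g i).2 ∧ (g i).2 ≤ P) := fun i hi hi' =>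
    Nat.findGreatest_is_greatest hi (by omega)
  have hst : ∀ i, A ≤ i → i < s → |(g (i + 1)).2 - (g i).2| ≤ 1 := by
    intro i _ hi
    obtain ⟨t, ht⟩ := hg i (by omega)
    exact ht.abs_le
  refine (ih A (by omega) (by omega) hA).trans ?_
  have hside : (∀ i, A < i → i < s → P < (g i).2) ∨ ∀ i, A < i → i < s → (g i).2 < -N := by
    by_cases h1 : A + 1 < s
    · by_cases h2 : P < (g (A + 1)).2
      · left
        intro i hi
        induction i, (show A + 1 ≤ i from hi) using Nat.le_induction with
        | base => exact fun _ => h2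
        | succ i hi' ih' =>
          intro hlt
          have e1 := ih' (by omega) (by omega)
          have e2 := hout _ hi hlt
          have e3 := hst i (by omega) (by omega)
          rw [abs_le] at e3
          omega
      · right
        intro i hi
        induction i, (show A + 1 ≤ i from hi) using Nat.le_induction with
        | base =>
          intro hlt
          have e2 := hout _ hi hlt
          omega
        | succ i hi' ih' =>
          intro hlt
          have e1 := ih' (by omega) (by omega)
          have e2 := hout _ hi hlt
          have e3 := hst i (by omega) (by omega)
          rw [abs_le] at e3
          omega
    · left
      intro i h2 h3
      omega
  rcases hside with hside | hside
  · have hlow : ∀ i, A ≤ i → i ≤ s → -N - 3 * Fintype.card Q ≤ (g i).2 := by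
      intro i h1 h2
      rcases h1.eq_or_lt with rfl | h1
      · omega
      rcases h2.eq_or_lt with rfl | h2
      · omega
      have := hside i h1 h2
      omega
    rcases F.excursion O.abs_pos_le g (by omega) hA.2 hsr.2 hst (by
        intro i h1 h2
        obtain ⟨t, ht⟩ := hg i (by omega)
        exact ht.mem_pos (by have := hside i h1 h2; omega)) with h | ⟨τ, τ', h1, h2, h3, h4, h5, h6⟩
    · exact macroReachable_of_low F G (by omega) (fun i _ hi => hg i (by omega))
        fun i hi hi' => ⟨hlow i hi hi', h i hi hi'⟩
    · have z1 : ∀ i, A ≤ i → i ≤ τ → InZone P N (g i) := fun i hi hi' =>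
        ⟨hlow i hi (by omega), h5 i hi hi'⟩
      have z2 : ∀ i, τ' ≤ i → i ≤ s → InZone P N (g i) := fun i hi hi' =>
        ⟨hlow i (by omega) hi', h6 i hi hi'⟩
      exact ((macroReachable_of_low F G h1.le (fun i _ hi => hg i (by omega)) z1).tail
        ⟨z1 τ h1.le le_rfl, z2 τ' le_rfl h3.le, .inr (.inl h4)⟩).trans
        (macroReachable_of_low F G h3.le (fun i _ hi => hg i (by omega)) z2)
  · have hlow : ∀ i, A ≤ i → i ≤ s → (g i).2 ≤ P + 3 * Fintype.card Q := by
      intro i h1 h2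
      rcases h1.eq_or_lt with rfl | h1
      · omega
      rcases h2.eq_or_lt with rfl | h2
      · omega
      have := hside i h1 h2
      omega
    rcases G.excursion O.abs_negGraph_le (fun i => mirror (g i)) (P := N) (A := A) (B := s)
        (by omega) (by dsimp only [mirror]; omega) (by dsimp only [mirror]; omega) (by
        intro i h1 h2
        have := hst i h1 h2
        rw [abs_le] at this ⊢
        dsimp only [mirror]
        omega) (by
        intro i h1 h2
        obtain ⟨t, ht⟩ := hg i (by omega)
        exact ht.mem_negGraph (by have := hside i h1 h2; omega)) with
      h | ⟨τ, τ', h1, h2, h3, h4, h5, h6⟩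
    · refine macroReachable_of_low F G (by omega) (fun i _ hi => hg i (by omega))
        fun i hi hi' => ⟨?_, hlow i hi hi'⟩
      have := h i hi hi'
      dsimp only [mirror] at this
      omega
    · have z1 : ∀ i, A ≤ i → i ≤ τ → InZone P N (g i) := fun i hi hi' =>
        ⟨by have := h5 i hi hi'; dsimp only [mirror] at this; omega, hlow i hi (by omega)⟩
      have z2 : ∀ i, τ' ≤ i → i ≤ s → InZone P N (g i) := fun i hi hi' =>
        ⟨by have := h6 i hi hi'; dsimp only [mirror] at this; omega, hlow i (by omega) hi'⟩
      exact ((macroReachable_of_low F G h1.le (fun i _ hi => hg i (by omega)) z1).tail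
        ⟨z1 τ h1.le le_rfl, z2 τ' le_rfl h3.le, .inr (.inr h4)⟩).trans
        (macroReachable_of_low F G h3.le (fun i _ hi => hg i (by omega)) z2)

end ZOCS

/-! ### The final bound -/

open ZOCS in
theorem mainTheorem4 {Q : Type*} [Fintype Q] (O : ZOCS Q) (α β : Q × ℤ)
    (h : O.Reachable α β) :
    ∃ ρ, O.IsPath α ρ β ∧
      ρ.length ≤ 56 * Fintype.card Q ^ 2 + Fintype.card Q * (α.2.natAbs + β.2.natAbs) := by
  classical
  obtain ⟨ρ₀, hρ₀⟩ := h
  obtain ⟨m, g, rfl, rfl, hg⟩ := hρ₀.exists_seq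
  obtain ⟨F⟩ := Frame.nonempty O.pos
  obtain ⟨G⟩ := Frame.nonempty O.negGraph
  obtain ⟨P, hP, hPα, hPβ, N, hN, hNα, hNβ, hPN⟩ : ∃ P : ℤ, 0 ≤ P ∧ (g 0).2 ≤ P ∧ (g m).2 ≤ P ∧
      ∃ N : ℤ, 0 ≤ N ∧ -N ≤ (g 0).2 ∧ -N ≤ (g m).2 ∧
        P + N ≤ ((g 0).2.natAbs + (g m).2.natAbs : ℕ) :=
    ⟨max 0 (max (g 0).2 (g m).2), by omega, by omega, by omega,
      max 0 (max (-(g 0).2) (-(g m).2)), by omega, by omega, by omega, by omega⟩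
  have hreach := macroReachable F G hP hN hg ⟨hNα, hPα⟩ m le_rfl ⟨hNβ, hPβ⟩
  obtain ⟨L, f, hf0, hfL, hstep, hshort, hinj⟩ := exists_shortest_seq hreach
  have hzone : ∀ i ≤ L, InZone P N (f i) := by
    intro i hi
    rcases hi.eq_or_lt with rfl | hi
    · rw [hfL]
      exact ⟨by omega, by omega⟩
    · exact (hstep i hi).1
  have hn : 0 < Fintype.card Q := Fintype.card_pos_iff.2 ⟨(g 0).1⟩
  have hL : L + 1 ≤ Fintype.card Q * (P + N + 6 * Fintype.card Q + 1).toNat := by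
    have := Finset.card_le_card_of_injOn (s := Finset.range (L + 1))
      (t := (Finset.univ : Finset Q) ×ˢ
        Finset.Icc (-N - 3 * Fintype.card Q : ℤ) (P + 3 * Fintype.card Q)) f (by
        intro i hi
        have := hzone i (by simpa [Nat.lt_succ_iff] using hi)
        simpa [InZone] using this) (by
        intro i hi j hj hij
        simp only [Finset.coe_range, Set.mem_Iio] at hi hj
        rcases lt_trichotomy i j with hlt | heq | hlt
        · exact absurd hij (hinj i j hlt (by omega))
        · exact heq
        · exact absurd hij.symm (hinj j i hlt (by omega)))
    rw [Finset.card_range, Finset.card_product, Finset.card_univ, Int.card_Icc] at this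
    convert this using 3
    ring
  -- A jump from the source of one jump to the target of a later one would be a shortcut among macro
  -- steps.
  obtain ⟨len, hlen, hsum⟩ := F.exists_runs O.abs_pos_le hP
    ((Finset.range L).filter fun i => F.Jump P (f i) (f (i + 1))) f (fun i => f (i + 1))
    (fun i hi => (Finset.mem_filter.1 hi).2) (by
      intro i hi j hj hij hJ
      simp only [Finset.mem_filter, Finset.mem_range] at hi hj
      exact hshort i j hij hj.1 ⟨hzone _ hi.1.le, hzone _ hj.1, .inr (.inl hJ)⟩)
  obtain ⟨len', hlen', hsum'⟩ := G.exists_runs O.abs_negGraph_le hN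
    ((Finset.range L).filter fun i => G.Jump N (mirror (f i)) (mirror (f (i + 1))))
    (fun i => mirror (f i)) (fun i => mirror (f (i + 1)))
    (fun i hi => (Finset.mem_filter.1 hi).2) (by
      intro i hi j hj hij hJ
      simp only [Finset.mem_filter, Finset.mem_range] at hi hj
      exact hshort i j hij hj.1 ⟨hzone _ hi.1.le, hzone _ hj.1, .inr (.inr hJ)⟩)
  obtain ⟨ρ, hρ, hle⟩ := exists_isPath_of_seq (O := O) (f := f)
    (cost := fun i => 1 + (if F.Jump P (f i) (f (i + 1)) then len i else 0) +
      (if G.Jump N (mirror (f i)) (mirror (f (i + 1))) then len' i else 0)) L (by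
      intro i hi
      obtain ⟨-, -, ⟨t, ht⟩ | hJ | hJ⟩ := hstep i hi
      · exact ⟨_, .cons ht (.nil _), by simp only [List.length_cons, List.length_nil]; omega⟩
      · obtain ⟨ρ, h1, h2⟩ := exists_isPath_of_posRun (hlen i (by simp [hi, hJ]))
        refine ⟨ρ, h1, ?_⟩
        rw [if_pos hJ]; omega
      · obtain ⟨ρ, h1, h2⟩ := exists_isPath_of_posRun_mirror (hlen' i (by simp [hi, hJ]))
        refine ⟨ρ, by simpa [mirror] using h1, ?_⟩
        rw [if_pos hJ]; omega)
  rw [hf0, hfL] at hρ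
  refine ⟨ρ, hρ, hle.trans ?_⟩
  rw [Finset.sum_add_distrib, Finset.sum_add_distrib, ← Finset.sum_filter, ← Finset.sum_filter,
    Finset.sum_const, Finset.card_range, smul_eq_mul, mul_one]
  have hL' : L ≤ Fintype.card Q *
      ((g 0).2.natAbs + (g m).2.natAbs + 6 * Fintype.card Q + 1) :=
    (Nat.le_succ L).trans (hL.trans (Nat.mul_le_mul_left _ (by omega)))
  -- Each sign costs 17n² and the macro steps add 6n² + n, so the quadratic part is at most 41n²,
  -- within the allowed 56n².
  nlinarith
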